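/- Let $A$ be a non-zero finite-dimensional algebra over a field $k$; all modules are finitely generated left $A$-modules. Let $M$ be a non-zero basic $\tau$-rigid module (that is, $\operatorname{Hom}_A(M,\tau M)=0$, where $\tau$ is the Auslander–Reiten translation, and the summands in a decomposition of $M$ into indecomposables are pairwise non-isomorphic), and let $M=\bigoplus_{i=1}^t M_i$ be a decomposition into indecomposable modules that is torsion free admissible: $M_i\notin\mathrm{Fac}(\overline M_i)$ for every $i\in\{1,\dots,t\}$, where $\overline M_i:=\bigoplus_{k>i}M_k$. Here $\mathrm{Fac}(X)$ is the class of quotients of the modules $X^n$, $\mathrm{add}(X)$ is the class of direct summands of the modules $X^n$ $(n\ge 0)$, and $X^\perp=\{Y:\operatorname{Hom}_A(X,Y)=0\}$. Then for every $i$ the pair $(\mathrm{Fac}(\overline M_i),\overline M_i^\perp)$ is a torsion pair, $M_i$ has a canonical exact sequence $$0\to \mathrm t_{i+1}(M_i)\to M_i\xrightarrow{\ \beta_i\ }\Delta_M(i)\to 0,\qquad \mathrm t_{i+1}(M_i)\in\mathrm{Fac}(\overline M_i),\quad \Delta_M(i)\in\overline M_i^\perp,$$ with respect to it, and $M_i$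 has a right minimal $\mathrm{add}(\overline M_i)$-approximation $h_i:N_i\to M_i$ (every map from a module in $\mathrm{add}(\overline M_i)$ to $M_i$ factors through $h_i$, $N_i\in\mathrm{add}(\overline M_i)$, and $h_i g=h_i$ implies that $g$ is an automorphism). Let $\Delta_M=\{\Delta_M(i)\}_{i=1}^t$ (the $M$-standard system) and let $\mathrm{Tr}_{\overline M_i}(M_i)$ be the sum of the images of all homomorphisms $\overline M_i\to M_i$. For all such sequences and approximations the following hold. (a) $\operatorname{Im}(h_i)=\mathrm t_{i+1}(M_i)=\mathrm{Tr}_{\overline M_i}(M_i)$ and $\Delta_M(i)\cong M_i/\mathrm{Tr}_{\overline M_i}(M_i)$ for all $i$. (b) $\beta_i:M_i\to\Delta_M(i)$ is a right minimal $\mathrm{add}(M)$-approximation of $\Delta_M(i)$ for all $i$. (c) Every module that has a finite filtration by submodules whose successive quotients are isomorphic to modules in $\Delta_M$ lies in $\mathrm{Fac}(M)$, that is, $\mathcal F(\Delta_M)\subseteq\mathrm{Fac}(M)$; and $\mathrm{Fac}(M)$ is the smallest torsion class containing $\Delta_M$. -/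

import Mathlib

open CategoryTheory

universe u w

namespace FDMod

/-! Throughout, `mod A` (finitely generated left `A`-modules) is `FGModuleCat.{u} A`, a full
subcategory of `mod A` is an `ObjectProperty (FGModuleCat.{u} A)`, and morphisms are `A`-linear
maps.  Finite direct sums are realised as finite products `Π j, N j`. -/

section Modules

variable {A : Type u} [Ring A]

/-- A module is indecomposable if it is non-zero and not the internal direct sum of two non-zero
submodules. -/
def Indecomposable (X : FGModuleCat.{u} A) : Prop :=
  Nontrivial X ∧ ∀ U V : Submodule A X, IsCompl U V → U = ⊥ ∨ V = ⊥

/-- A module is basic if, in a decomposition as a finite direct sum of indecomposable modules, the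
summands are pairwise non-isomorphic (such decompositions exist and are essentially unique for
modules of finite length, so it does not matter which one is taken). -/
def IsBasic (M : FGModuleCat.{u} A) : Prop :=
  ∀ (n : ℕ) (N : Fin n → FGModuleCat.{u} A), (∀ i, Indecomposable (N i)) →
    Nonempty (M ≃ₗ[A] (∀ i, N i)) → ∀ i j, i ≠ j → IsEmpty (N i ≃ₗ[A] N j)

/-- `Fac M`: the quotients of the finite direct sums `M ^ n`. -/
def Fac (M : FGModuleCat.{u} A) : ObjectProperty (FGModuleCat.{u} A) :=
  fun X => ∃ (n : ℕ) (f : (Fin n → M) →ₗ[A] X), Function.Surjective f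

/-- `add M`: the direct summands of the finite direct sums `M ^ n`. -/
def addClosure (M : FGModuleCat.{u} A) : ObjectProperty (FGModuleCat.{u} A) :=
  fun X => ∃ (n : ℕ) (Z : FGModuleCat.{u} A), Nonempty ((X × Z) ≃ₗ[A] (Fin n → M))

/-- The right perpendicular category `M^⊥`, the modules `X` with `Hom_A(M, X) = 0`. -/
def rightPerp (M : FGModuleCat.{u} A) : ObjectProperty (FGModuleCat.{u} A) :=
  fun X => ∀ f : M →ₗ[A] X, f = 0

/-- `(T, F)` is a torsion pair in `mod A`: `T = ^⊥F` and `F = T^⊥`. -/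
structure IsTorsionPair (T F : ObjectProperty (FGModuleCat.{u} A)) : Prop where
  left : ∀ X, T X ↔ ∀ Y, F Y → ∀ f : X →ₗ[A] Y, f = 0
  right : ∀ Y, F Y ↔ ∀ X, T X → ∀ f : X →ₗ[A] Y, f = 0

/-- A torsion class is the first member of a torsion pair. -/
def IsTorsionClass (T : ObjectProperty (FGModuleCat.{u} A)) : Prop :=
  ∃ F, IsTorsionPair T F

/-- `0 → L → X → Y → 0` (with maps `ι`, `β`) is a canonical short exact sequence of `X` with respect
to the torsion pair `(T, F)`: it is exact, `L` is in `T` and `Y` is in `F`. -/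
structure IsCanonicalSequence (T F : ObjectProperty (FGModuleCat.{u} A))
    {L X Y : FGModuleCat.{u} A} (ι : L →ₗ[A] X) (β : X →ₗ[A] Y) : Prop where
  injective : Function.Injective ι
  exact : Function.Exact ι β
  surjective : Function.Surjective β
  torsion : T L
  torsionFree : F Y

/-- `f : X → Y` is a right `C`-approximation of `Y`: `X` is in `C` and every map from an object of
`C` to `Y` factors through `f`. -/
def IsRightApprox (C : ObjectProperty (FGModuleCat.{u} A))
    {X Y : FGModuleCat.{u} A} (f : X →ₗ[A] Y) : Prop :=
  C X ∧ ∀ X' : FGModuleCat.{u} A, C X' → ∀ g : X' →ₗ[A] Y, ∃ h : X' →ₗ[A] X, f ∘ₗ h = g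

/-- A right minimal `C`-approximation (a `C`-cover): a right `C`-approximation `f` such that
`f h = f` forces `h` to be an automorphism. -/
def IsRightMinimalApprox (C : ObjectProperty (FGModuleCat.{u} A))
    {X Y : FGModuleCat.{u} A} (f : X →ₗ[A] Y) : Prop :=
  IsRightApprox C f ∧ ∀ h : X →ₗ[A] X, f ∘ₗ h = f → Function.Bijective h

/-- The trace of `X` in `Y`: the sum of the images of all maps `X → Y`. -/
def trace (X Y : FGModuleCat.{u} A) : Submodule A Y :=
  ⨆ f : X →ₗ[A] Y, LinearMap.range f

/-- `Filt C` is the class of modules `X` with a chain `0 = c 0 ⊆ c 1 ⊆ … ⊆ c n = X` of submodules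
whose successive quotients are isomorphic to objects of `C`. -/
def Filt (C : ObjectProperty (FGModuleCat.{u} A)) : ObjectProperty (FGModuleCat.{u} A) :=
  fun X => ∃ (n : ℕ) (c : ℕ → Submodule A X), c 0 = ⊥ ∧ c n = ⊤ ∧
    ∀ j < n, c j ≤ c (j + 1) ∧ ∃ Y : FGModuleCat.{u} A, C Y ∧
      Nonempty ((c (j + 1) ⧸ (c j).submoduleOf (c (j + 1))) ≃ₗ[A] Y)

/-- The direct sum of the `N j` with `j > i`. -/
abbrev tail {t : ℕ} (N : Fin t → FGModuleCat.{u} A) (i : Fin t) : FGModuleCat.{u} A :=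
  FGModuleCat.of A (∀ j : {j : Fin t // i < j}, N j)

/-- `N 0, …, N (t - 1)` is a TF-admissible decomposition of `M`: the `N i` are indecomposable, `M` is
isomorphic to their direct sum, and no `N i` is in `Fac (⨁_{j > i} N j)`. -/
structure IsTFAdmissible (M : FGModuleCat.{u} A) {t : ℕ} (N : Fin t → FGModuleCat.{u} A) :
    Prop where
  indecomposable : ∀ i, Indecomposable (N i)
  decomposition : Nonempty (M ≃ₗ[A] (∀ i, N i))
  notMem_Fac : ∀ i, ¬ Fac (tail N i) (N i)

/-- A submodule `K` of `X` is superfluous if `U + K = X` forces `U = X`. -/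
def IsSuperfluous {X : FGModuleCat.{u} A} (K : Submodule A X) : Prop :=
  ∀ U : Submodule A X, U ⊔ K = ⊤ → U = ⊤

/-- A minimal projective presentation `P₁ → P₀ → M → 0` in `mod A`: an exact sequence with `P₀` and
`P₁` projective such that `P₀ → M` and `P₁ → ker (P₀ → M)` are projective covers. -/
structure MinimalProjectivePresentation (M : FGModuleCat.{u} A) where
  P₁ : FGModuleCat.{u} A
  P₀ : FGModuleCat.{u} A
  projective₁ : Module.Projective A P₁
  projective₀ : Module.Projective A P₀
  d₁ : P₁ →ₗ[A] P₀
  d₀ : P₀ →ₗ[A] M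
  exact : Function.Exact d₁ d₀
  surjective : Function.Surjective d₀
  superfluous₁ : IsSuperfluous (LinearMap.ker d₁)
  superfluous₀ : IsSuperfluous (LinearMap.ker d₀)

/-- The transpose `Tr M`: the cokernel of `Hom_A(d₁, A) : Hom_A(P₀, A) → Hom_A(P₁, A)`, a right
`A`-module, i.e. an `Aᵐᵒᵖ`-module. -/
abbrev MinimalProjectivePresentation.Tr {M : FGModuleCat.{u} A}
    (P : MinimalProjectivePresentation M) : Type u :=
  (P.P₁ →ₗ[A] A) ⧸ LinearMap.range (LinearMap.lcomp Aᵐᵒᵖ A P.d₁)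

end Modules

section Translate

/-- The standard duality `D = Hom_k(-, k)`, applied to a right `A`-module `N`. -/
def StdDual (k : Type w) (N : Type u) [Field k] [AddCommGroup N] [Module k N] : Type (max u w) :=
  N →ₗ[k] k

/-- The linear form underlying an element of the dual. -/
def StdDual.form {k : Type w} {N : Type u} [Field k] [AddCommGroup N] [Module k N]
    (φ : StdDual k N) : N →ₗ[k] k := φ

variable (k : Type w) [Field k] {A : Type u} [Ring A] [Algebra k A]

instance (N : Type u) [AddCommGroup N] [Module k N] : AddCommGroup (StdDual k N) :=
  inferInstanceAs (AddCommGroup (N →ₗ[k] k))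

/-- Right multiplication by `a` on a right `A`-module, as a `k`-linear map. -/
def rightMul (N : Type u) [AddCommGroup N] [Module k N] [Module Aᵐᵒᵖ N]
    [IsScalarTower k Aᵐᵒᵖ N] (a : A) : N →ₗ[k] N where
  toFun n := MulOpposite.op a • n
  map_add' x y := smul_add _ x y
  map_smul' c x := by
    rw [RingHom.id_apply, ← algebraMap_smul Aᵐᵒᵖ c x,
      ← algebraMap_smul Aᵐᵒᵖ c (MulOpposite.op a • x), smul_smul, smul_smul, Algebra.commutes]

/-- The left `A`-module structure `(a • φ) n = φ (n a)` on the dual of a right `A`-module. -/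
instance (N : Type u) [AddCommGroup N] [Module k N] [Module Aᵐᵒᵖ N] [IsScalarTower k Aᵐᵒᵖ N] :
    Module A (StdDual k N) where
  smul a φ := φ.form ∘ₗ rightMul k N a
  one_smul φ := by
    refine LinearMap.ext fun n => ?_
    change φ.form (MulOpposite.op (1 : A) • n) = φ.form n
    rw [MulOpposite.op_one, one_smul]
  mul_smul a b φ := by
    refine LinearMap.ext fun n => ?_
    change φ.form (MulOpposite.op (a * b) • n)
      = φ.form (MulOpposite.op b • MulOpposite.op a • n)
    rw [MulOpposite.op_mul, mul_smul]
  smul_zero a := rfl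
  smul_add a φ ψ := rfl
  add_smul a b φ := by
    refine LinearMap.ext fun n => ?_
    change φ.form (MulOpposite.op (a + b) • n)
      = φ.form (MulOpposite.op a • n) + φ.form (MulOpposite.op b • n)
    rw [MulOpposite.op_add, add_smul, map_add]
  zero_smul φ := by
    refine LinearMap.ext fun n => ?_
    change φ.form (MulOpposite.op (0 : A) • n) = 0
    rw [MulOpposite.op_zero, zero_smul, map_zero]

/-- The action is `(a • φ) n = φ (n a)`. -/
theorem StdDual.smul_form (N : Type u) [AddCommGroup N] [Module k N] [Module Aᵐᵒᵖ N]
    [IsScalarTower k Aᵐᵒᵖ N] (a : A) (φ : StdDual k N) (n : N) :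
    (a • φ).form n = φ.form (MulOpposite.op a • n) := rfl

/-- The Auslander-Reiten translate `τ M = D Tr M`, a left `A`-module. -/
abbrev MinimalProjectivePresentation.tau {M : FGModuleCat.{u} A}
    (P : MinimalProjectivePresentation M) : Type (max u w) :=
  StdDual k P.Tr

/-- `M` is `τ`-rigid: `Hom_A(M, τ M) = 0`.  Over a finite-dimensional algebra a minimal projective
presentation of `M` exists and is unique up to isomorphism, so it does not matter which one is
used to compute `τ M`. -/
def IsTauRigid (M : FGModuleCat.{u} A) : Prop :=
  ∃ P : MinimalProjectivePresentation M, ∀ f : M →ₗ[A] P.tau k, f = 0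

end Translate

end FDMod

open FDMod

/-! τ-rigidity enters only through `Ext¹(M, Fac M) = 0`. A linear form on the cokernel of `Hom(d₁,
M)` induces a map `M → D Tr M`, so `Hom(M, τM) = 0` forces every map `P₁ → M` to factor through `d₁`
(`exists_factor`), and then maps from `M` lift along epimorphisms with kernel in `Fac M`
(`liftsModuloFac`). This passes to direct summands in both arguments.

For a summand `U` of `M`, a map from `U` to `X` modulo the trace of `U` lifts to `X`, so it lands in
the trace and vanishes. This gives the torsion pair and its canonical sequences, and (a) holds
because both images are the trace. In (b), maps from `M` lift along `β i` because its kernel lies in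
`Fac (tail N i)`; minimality is Fitting's lemma together with `β i ≠ 0`, which is admissibility. For
(c), torsion classes are closed under quotients and extensions, and descending induction on `i`
recovers each `N i` from `Δ i` and the later summands. -/

namespace FDMod

section Modules

variable {A : Type u} [Ring A]

/-! ### Lifting modulo `Fac M` from a projective presentation. -/

/-- Maps from `U` lift along every epimorphism whose kernel is in `Fac M`, i.e.
`Ext¹(U, Fac M) = 0`. -/
def LiftsModuloFac (U M : FGModuleCat.{u} A) : Prop :=
  ∀ (E Y : FGModuleCat.{u} A) (p : E →ₗ[A] Y), Function.Surjective p →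
    ∀ (n : ℕ) (q : (Fin n → M) →ₗ[A] E), LinearMap.range q = LinearMap.ker p →
      ∀ g : U →ₗ[A] Y, ∃ g' : U →ₗ[A] E, p ∘ₗ g' = g

/-- `U` is a direct summand of `M`. -/
def IsRetract (U M : FGModuleCat.{u} A) : Prop :=
  ∃ (i : U →ₗ[A] M) (r : M →ₗ[A] U), r ∘ₗ i = LinearMap.id

/-- Projectivity of `P₀` lifts `g ∘ d₀` to `s : P₀ → E`. On the image of `d₁`, `s` takes values in
`ker p = range q`, so `s ∘ d₁` lifts to `v : P₁ → Mⁿ`, which `hP` extends to `P₀` coordinatewise.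
Subtracting `q` of this extension makes `s` vanish on `ker d₀`, and `p` does not see the correction.
-/
theorem MinimalProjectivePresentation.liftsModuloFac {M : FGModuleCat.{u} A}
    (P : MinimalProjectivePresentation M)
    (hP : ∀ f : P.P₁ →ₗ[A] M, ∃ g : P.P₀ →ₗ[A] M, g ∘ₗ P.d₁ = f) : LiftsModuloFac M M := by
  intro E Y p hp n q hq g
  have := P.projective₀
  have := P.projective₁
  obtain ⟨s, hs⟩ := Module.projective_lifting_property p (g ∘ₗ P.d₀) hp
  have hmem : ∀ x, s (P.d₁ x) ∈ LinearMap.range q := fun x => by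
    rw [hq, LinearMap.mem_ker]
    have h1 := LinearMap.congr_fun hs (P.d₁ x)
    simp only [LinearMap.comp_apply, P.exact.apply_apply_eq_zero, map_zero] at h1
    exact h1
  obtain ⟨v, hv⟩ := Module.projective_lifting_property q.rangeRestrict
    ((s ∘ₗ P.d₁).codRestrict (LinearMap.range q) hmem) q.surjective_rangeRestrict
  choose w hw using fun j : Fin n => hP (LinearMap.proj j ∘ₗ v)
  have hwv : LinearMap.pi w ∘ₗ P.d₁ = v := by
    ext x j
    exact LinearMap.congr_fun (hw j) x
  have hqv : ∀ x, q (v x) = s (P.d₁ x) := fun x => congrArg Subtype.val (LinearMap.congr_fun hv x)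
  have hker : LinearMap.ker P.d₀ ≤ LinearMap.ker (s - q ∘ₗ LinearMap.pi w) := by
    intro y hy
    obtain ⟨x, rfl⟩ := (P.exact y).1 hy
    have h2 := LinearMap.congr_fun hwv x
    rw [LinearMap.comp_apply] at h2
    rw [LinearMap.mem_ker, LinearMap.sub_apply, LinearMap.comp_apply, h2, hqv, sub_self]
  have hpq : ∀ z, p (q z) = 0 := fun z => by
    rw [← LinearMap.mem_ker, ← hq]; exact ⟨z, rfl⟩
  let e := P.d₀.quotKerEquivOfSurjective P.surjective
  refine ⟨(LinearMap.ker P.d₀).liftQ _ hker ∘ₗ e.symm.toLinearMap, ?_⟩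
  ext m
  obtain ⟨y, rfl⟩ := P.surjective m
  have he : e.symm (P.d₀ y) = (LinearMap.ker P.d₀).mkQ y := by
    rw [LinearEquiv.symm_apply_eq]; rfl
  have h3 := LinearMap.congr_fun hs y
  simp only [LinearMap.comp_apply] at h3
  simp only [LinearMap.comp_apply, LinearEquiv.coe_coe, he, Submodule.mkQ_apply,
    Submodule.liftQ_apply, LinearMap.sub_apply, map_sub, hpq, sub_zero, h3]

theorem LiftsModuloFac.of_isRetract {M U : FGModuleCat.{u} A} (h : LiftsModuloFac M M)
    (hU : IsRetract U M) : LiftsModuloFac U M := by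
  obtain ⟨i, r, hri⟩ := hU
  intro E Y p hp n q hq g
  obtain ⟨g', hg'⟩ := h E Y p hp n q hq (g ∘ₗ r)
  exact ⟨g' ∘ₗ i, by rw [← LinearMap.comp_assoc, hg', LinearMap.comp_assoc, hri,
    LinearMap.comp_id]⟩

/-! ### `Fac`, `add` and traces. -/

theorem Fac.of_surjective {M X Y : FGModuleCat.{u} A} (h : Fac M X) (f : X →ₗ[A] Y)
    (hf : Function.Surjective f) : Fac M Y := by
  obtain ⟨n, g, hg⟩ := h
  exact ⟨n, f ∘ₗ g, hf.comp hg⟩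

theorem Fac.self (M : FGModuleCat.{u} A) : Fac M M :=
  ⟨1, LinearMap.proj 0, fun m => ⟨fun _ => m, rfl⟩⟩

/-- Post-composition on each coordinate. -/
def powMap {M U : Type*} [AddCommGroup M] [Module A M] [AddCommGroup U] [Module A U]
    (n : ℕ) (r : M →ₗ[A] U) : (Fin n → M) →ₗ[A] (Fin n → U) :=
  LinearMap.pi fun j => r ∘ₗ LinearMap.proj j

theorem powMap_surjective {M U : Type*} [AddCommGroup M] [Module A M] [AddCommGroup U]
    [Module A U] (n : ℕ) {r : M →ₗ[A] U} (hr : Function.Surjective r) :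
    Function.Surjective (powMap n r) := fun y => by
  choose x hx using fun j => hr (y j)
  exact ⟨x, funext hx⟩

theorem IsRetract.surjective {U M : FGModuleCat.{u} A} {i : U →ₗ[A] M} {r : M →ₗ[A] U}
    (h : r ∘ₗ i = LinearMap.id) : Function.Surjective r :=
  fun x => ⟨i x, LinearMap.congr_fun h x⟩

/-- Maps out of objects of `Fac M` into `M^⊥` vanish. -/
theorem Fac.eq_zero {M X Y : FGModuleCat.{u} A} (hX : Fac M X) (hY : rightPerp M Y)
    (f : X →ₗ[A] Y) : f = 0 := by
  obtain ⟨n, g, hg⟩ := hX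
  have : f ∘ₗ g = 0 := by
    refine LinearMap.pi_ext' fun j => ?_
    rw [LinearMap.zero_comp]
    exact hY _
  ext x
  obtain ⟨y, rfl⟩ := hg x
  exact LinearMap.congr_fun this y

/-- The complement is `ker r`, finitely generated because `A` is Noetherian. -/
theorem addClosure_iff {M X : FGModuleCat.{u} A} [IsNoetherianRing A] : addClosure M X ↔
    ∃ (n : ℕ) (i : X →ₗ[A] (Fin n → M)) (r : (Fin n → M) →ₗ[A] X), r ∘ₗ i = LinearMap.id := by
  constructor
  · rintro ⟨n, Z, ⟨e⟩⟩
    refine ⟨n, e.toLinearMap ∘ₗ LinearMap.inl A X Z, LinearMap.fst A X Z ∘ₗ e.symm.toLinearMap, ?_⟩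
    ext x
    simp
  · rintro ⟨n, i, r, h⟩
    have hri : ∀ x, r (i x) = x := LinearMap.congr_fun h
    refine ⟨n, FGModuleCat.of A (LinearMap.ker r), ⟨LinearEquiv.ofBijective
      (LinearMap.coprod i (LinearMap.ker r).subtype) ⟨?_, ?_⟩⟩⟩
    · rw [injective_iff_map_eq_zero]
      rintro ⟨x, z⟩ hxz
      have hxz' : i x + (z : Fin n → M) = 0 := hxz
      have h1 := congrArg r hxz'
      rw [map_add, hri, LinearMap.mem_ker.1 z.2, add_zero, map_zero] at h1
      subst h1
      rw [map_zero, zero_add] at hxz'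
      exact Prod.ext rfl (Subtype.ext hxz')
    · intro y
      refine ⟨(r y, ⟨y - i (r y), ?_⟩), ?_⟩
      · rw [LinearMap.mem_ker, map_sub, hri, sub_self]
      · exact add_sub_cancel (i (r y)) y

theorem addClosure.of_isRetract [IsNoetherianRing A] {M X Y : FGModuleCat.{u} A}
    (h : addClosure M X) (hY : IsRetract Y X) : addClosure M Y := by
  rw [addClosure_iff] at h ⊢
  obtain ⟨n, i, r, hri⟩ := h
  obtain ⟨i', r', hri'⟩ := hY
  refine ⟨n, i ∘ₗ i', r' ∘ₗ r, ?_⟩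
  rw [LinearMap.comp_assoc, ← LinearMap.comp_assoc i' i r, hri, LinearMap.id_comp, hri']

theorem addClosure.pow (M : FGModuleCat.{u} A) (n : ℕ) :
    addClosure M (FGModuleCat.of A (Fin n → M)) :=
  ⟨n, FGModuleCat.of A PUnit, ⟨LinearEquiv.prodUnique⟩⟩

theorem addClosure.self (M : FGModuleCat.{u} A) : addClosure M M :=
  ⟨1, FGModuleCat.of A PUnit, ⟨LinearEquiv.prodUnique ≪≫ₗ (LinearEquiv.funUnique (Fin 1) A M).symm⟩⟩

/-- If all maps from `U` to `Y` factor through `h`, then so do those from objects of `add U`. -/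
theorem addClosure.exists_factor [IsNoetherianRing A] {U X Y Z : FGModuleCat.{u} A}
    (hX : addClosure U X) (h : Z →ₗ[A] Y)
    (hh : ∀ g : U →ₗ[A] Y, ∃ g' : U →ₗ[A] Z, h ∘ₗ g' = g) (g : X →ₗ[A] Y) :
    ∃ g' : X →ₗ[A] Z, h ∘ₗ g' = g := by
  obtain ⟨n, i, r, hri⟩ := addClosure_iff.1 hX
  choose w hw using fun j : Fin n => hh (g ∘ₗ r ∘ₗ LinearMap.single A (fun _ => (U : Type u)) j)
  have : h ∘ₗ LinearMap.lsum A (fun _ : Fin n => (U : Type u)) ℕ w = g ∘ₗ r := by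
    refine LinearMap.pi_ext fun j x => ?_
    rw [LinearMap.comp_apply, LinearMap.lsum_piSingle]
    exact LinearMap.congr_fun (hw j) x
  exact ⟨LinearMap.lsum A (fun _ : Fin n => (U : Type u)) ℕ w ∘ₗ i, by
    rw [← LinearMap.comp_assoc, this, LinearMap.comp_assoc, hri, LinearMap.comp_id]⟩

theorem range_le_trace_of_Fac {U L X : FGModuleCat.{u} A} (hL : Fac U L) (f : L →ₗ[A] X) :
    LinearMap.range f ≤ FDMod.trace U X := by
  obtain ⟨n, g, hg⟩ := hL
  rw [← LinearMap.range_comp_of_range_eq_top f (LinearMap.range_eq_top.2 hg)]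
  rintro _ ⟨x, rfl⟩
  rw [← LinearMap.sum_single_apply (fun _ : Fin n => (U : Type u)) x, map_sum]
  refine Submodule.sum_mem _ fun j _ => ?_
  exact Submodule.mem_iSup_of_mem
    ((f ∘ₗ g) ∘ₗ LinearMap.single A (fun _ => (U : Type u)) j) ⟨x j, rfl⟩

theorem Fac.of_addClosure [IsNoetherianRing A] {U X : FGModuleCat.{u} A} (h : addClosure U X) :
    Fac U X := by
  obtain ⟨n, i, r, hri⟩ := addClosure_iff.1 h
  exact ⟨n, r, fun x => ⟨i x, LinearMap.congr_fun hri x⟩⟩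

theorem IsRightApprox.range_eq_trace [IsNoetherianRing A] {U X Y : FGModuleCat.{u} A}
    {h : X →ₗ[A] Y} (hh : IsRightApprox (addClosure U) h) :
    LinearMap.range h = FDMod.trace U Y := by
  refine le_antisymm (range_le_trace_of_Fac (Fac.of_addClosure hh.1) h) (iSup_le fun f => ?_)
  obtain ⟨g, rfl⟩ := hh.2 U (addClosure.self U) f
  exact LinearMap.range_comp_le_range g h

/-- Any `f : U → X` satisfies `β ∘ f = 0` since `Y` is in `U^⊥`, so its image lies in `ker β = range
ι`. -/
theorem IsCanonicalSequence.range_eq_trace {U L X Y : FGModuleCat.{u} A} {ι : L →ₗ[A] X}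
    {β : X →ₗ[A] Y} (h : IsCanonicalSequence (Fac U) (rightPerp U) ι β) :
    LinearMap.range ι = FDMod.trace U X := by
  refine le_antisymm (range_le_trace_of_Fac h.torsion ι) (iSup_le fun f => ?_)
  rw [← h.exact.linearMap_ker_eq]
  rintro _ ⟨x, rfl⟩
  exact LinearMap.congr_fun (h.torsionFree (β ∘ₗ f)) x

/-! ### Minimality via Fitting's lemma. -/

/-- If a right approximation exists, then one out of a module of minimal length is right minimal. -/
theorem IsRightApprox.exists_minimal [IsArtinianRing A] {U X Y : FGModuleCat.{u} A}
    {h : X →ₗ[A] Y} (hh : IsRightApprox (addClosure U) h) :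
    ∃ (X' : FGModuleCat.{u} A) (h' : X' →ₗ[A] Y), IsRightMinimalApprox (addClosure U) h' := by
  obtain ⟨⟨X', h'⟩, hX', hmin⟩ := (InvImage.wf
    (fun p : (X' : FGModuleCat.{u} A) × (X' →ₗ[A] Y) => Module.length A p.1)
    (wellFounded_lt (α := ℕ∞))).has_min {p | IsRightApprox (addClosure U) p.2} ⟨⟨X, h⟩, hh⟩
  refine ⟨X', h', hX', fun g hg => ?_⟩
  -- Fitting decomposition for `g`; `n ≥ 1` is needed to read off surjectivity of `g` from that of
  -- `g ^ n`.
  obtain ⟨n, hn, hcompl⟩ := ((Filter.eventually_ge_atTop 1).and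
    (LinearMap.eventually_isCompl_ker_pow_range_pow g)).exists
  have hgn : ∀ m : ℕ, h' ∘ₗ (g ^ m) = h' := fun m => by
    induction m with
    | zero => rfl
    | succ m ih => rw [pow_succ, Module.End.mul_eq_comp, ← LinearMap.comp_assoc, ih, hg]
  let R := LinearMap.range (g ^ n)
  -- The range of `g ^ n` is a summand of `X'`, and `h' ∘ g ^ n = h'`, so restricting `h'` to it
  -- still gives an approximation; minimal length forces it to be all of `X'`.
  have happ : IsRightApprox (addClosure U) (X := FGModuleCat.of A R) (h' ∘ₗ R.subtype) := by
    refine ⟨hX'.1.of_isRetract ⟨R.subtype, Submodule.projectionOnto _ _ hcompl.symm, ?_⟩, ?_⟩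
    · ext x
      exact congrArg _ (Submodule.projectionOnto_apply_left hcompl.symm x)
    · intro X'' hX'' f
      obtain ⟨f', hf'⟩ := hX'.2 X'' hX'' f
      refine ⟨(g ^ n).rangeRestrict ∘ₗ f', ?_⟩
      rw [← hf']
      exact congrArg (· ∘ₗ f') (hgn n)
  have hR : R = ⊤ := by
    by_contra hne
    exact hmin ⟨FGModuleCat.of A R, h' ∘ₗ R.subtype⟩ happ (Submodule.length_lt hne)
  have hsurj : Function.Surjective g := by
    intro y
    obtain ⟨m, rfl⟩ := Nat.exists_eq_add_of_le' hn
    obtain ⟨x, hx⟩ := LinearMap.range_eq_top.1 hR y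
    exact ⟨(g ^ m) x, by rw [← hx, pow_succ']; rfl⟩
  exact OrzechProperty.bijective_of_surjective_endomorphism g hsurj

/-- Endomorphisms of an indecomposable module of finite length are nilpotent or bijective. -/
theorem Indecomposable.isNilpotent_or_bijective [IsArtinianRing A] {X : FGModuleCat.{u} A}
    (hX : Indecomposable X) (g : X →ₗ[A] X) : (∃ n : ℕ, g ^ n = 0) ∨ Function.Bijective g := by
  obtain ⟨n, hn, hcompl⟩ := ((Filter.eventually_ge_atTop 1).and
    (LinearMap.eventually_isCompl_ker_pow_range_pow g)).exists
  rcases hX.2 _ _ hcompl with h | h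
  · right
    have hinj : Function.Injective g := by
      rw [← LinearMap.ker_eq_bot, eq_bot_iff, ← h]
      intro x hx
      obtain ⟨m, rfl⟩ := Nat.exists_eq_add_of_le' hn
      rw [LinearMap.mem_ker] at hx ⊢
      rw [pow_succ, Module.End.mul_apply, hx, map_zero]
    exact ⟨hinj, IsArtinian.surjective_of_injective_endomorphism g hinj⟩
  · exact Or.inl ⟨n, LinearMap.range_eq_bot.1 h⟩

end Modules

/-! ### The duality argument, approximations and torsion pairs over `k`. -/

section FiniteDimensional

variable {k : Type w} [Field k] {A : Type u} [Ring A] [Algebra k A]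

/-- For a `τ`-rigid module, all maps `P₁ → M` factor through `d₁ : P₁ → P₀`: a linear form on the
cokernel of `Hom(d₁, M)` gives a map `M → D Tr M`. -/
theorem MinimalProjectivePresentation.exists_factor {M : FGModuleCat.{u} A}
    (P : MinimalProjectivePresentation M) (hP : ∀ f : M →ₗ[A] P.tau k, f = 0)
    (f : P.P₁ →ₗ[A] M) : ∃ g : P.P₀ →ₗ[A] M, g ∘ₗ P.d₁ = f := by
  let _ : Module k M := Module.compHom M (algebraMap k A)
  have : IsScalarTower k A M := IsScalarTower.of_algebraMap_smul fun _ _ => rfl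
  by_contra hf
  let W : Submodule k (P.P₁ →ₗ[A] M) := LinearMap.range (LinearMap.lcomp k (M : Type u) P.d₁)
  have hfW : f ∉ W := fun ⟨g, hg⟩ => hf ⟨g, hg⟩
  obtain ⟨l, hlf, hlW⟩ := Submodule.exists_le_ker_of_notMem hfW
  have hlr : ∀ g : P.P₀ →ₗ[A] M, l (g ∘ₗ P.d₁) = 0 := fun g => hlW ⟨g, rfl⟩
  -- `Φ₀ m` sends `p` to the value of `l` at the map `x ↦ p x • m`; it vanishes on the image of
  -- `Hom(d₁, A)`, hence descends to `Tr M`.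
  let Φ₀ : M → (P.P₁ →ₗ[A] A) →ₗ[k] k := fun m =>
    { toFun := fun p => l ((LinearMap.toSpanSingleton A M m) ∘ₗ p)
      map_add' := fun p q => by rw [LinearMap.comp_add, map_add]
      map_smul' := fun c p => by
        rw [RingHom.id_apply, ← map_smul]
        congr 1
        ext x
        exact smul_assoc c (p x) m }
  let S := LinearMap.range (LinearMap.lcomp Aᵐᵒᵖ A P.d₁)
  have hS : ∀ m, S.restrictScalars k ≤ LinearMap.ker (Φ₀ m) := by
    rintro m _ ⟨q, rfl⟩
    exact hlr ((LinearMap.toSpanSingleton A M m) ∘ₗ q)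
  let Φ : M →ₗ[A] P.tau k :=
    { toFun := fun m => ((S.restrictScalars k).liftQ (Φ₀ m) (hS m) ∘ₗ
        (Submodule.Quotient.restrictScalarsEquiv k S).symm.toLinearMap : P.Tr →ₗ[k] k)
      map_add' := fun m m' => by
        refine LinearMap.ext fun z => ?_
        obtain ⟨p, rfl⟩ := Submodule.Quotient.mk_surjective _ z
        change l _ = l _ + l _
        rw [← map_add]
        congr 1
        ext x
        exact smul_add (p x) m m'
      map_smul' := fun a m => by
        refine LinearMap.ext fun z => ?_
        obtain ⟨p, rfl⟩ := Submodule.Quotient.mk_surjective _ z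
        change l _ = l _
        congr 1
        ext x
        exact (mul_smul (p x) a m).symm }
  have hΦ : ∀ m p, l ((LinearMap.toSpanSingleton A M m) ∘ₗ p) = 0 := fun m p =>
    LinearMap.congr_fun (LinearMap.congr_fun (hP Φ) m : (Φ m).form = (0 : P.tau k).form)
      (Submodule.Quotient.mk p)
  have := P.projective₁
  obtain ⟨n, u, v, -, -, huv⟩ := Module.Finite.exists_comp_eq_id_of_projective A P.P₁
  refine hlf ?_
  -- As `P₁` is a summand of some `Aⁿ`, a dual basis writes `f` as a sum of maps `x ↦ p x • m`. All
  -- are killed by `l`, contradicting `l f ≠ 0`.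
  have hsum : f = ∑ j, LinearMap.toSpanSingleton A M (f (u (Pi.single j 1))) ∘ₗ
      (LinearMap.proj j ∘ₗ v) := by
    ext x
    conv_lhs => rw [← LinearMap.id_apply (R := A) x, ← huv, LinearMap.comp_apply,
      pi_eq_sum_univ' (v x)]
    simp only [map_sum, map_smul, LinearMap.sum_apply, LinearMap.comp_apply, LinearMap.proj_apply,
      LinearMap.toSpanSingleton_apply]
  rw [hsum, map_sum]
  exact Finset.sum_eq_zero fun j _ => hΦ _ _

/-- Every module has a right `add U`-approximation by a power of `U`. -/
theorem exists_isRightApprox_pow [Module.Finite k A] [IsNoetherianRing A] (U X : FGModuleCat.{u} A) :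
    ∃ (n : ℕ) (h : (Fin n → U) →ₗ[A] X),
      IsRightApprox (addClosure U) (X := FGModuleCat.of A (Fin n → U)) h := by
  let _ : Module k U := Module.compHom U (algebraMap k A)
  have : IsScalarTower k A U := IsScalarTower.of_algebraMap_smul fun _ _ => rfl
  let _ : Module k X := Module.compHom X (algebraMap k A)
  have : IsScalarTower k A X := IsScalarTower.of_algebraMap_smul fun _ _ => rfl
  have : Module.Finite k U := Module.Finite.trans A U
  have : Module.Finite k X := Module.Finite.trans A X
  have : Module.Finite k (U →ₗ[A] X) := Module.Finite.of_injective
    (LinearMap.restrictScalarsₗ k A U X k) (LinearMap.restrictScalars_injective k)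
  -- The components of the approximation are a finite `k`-spanning family of `Hom(U, X)`; a
  -- combination with coefficients `c` factors through `u ↦ (c j • u)`.
  obtain ⟨n, s, hs⟩ := Module.Finite.exists_fin (R := k) (M := U →ₗ[A] X)
  refine ⟨n, LinearMap.lsum A (fun _ : Fin n => (U : Type u)) ℕ s, addClosure.pow U n,
    fun X' hX' g => hX'.exists_factor _ (fun g => ?_) g⟩
  obtain ⟨c, hc⟩ := (Submodule.mem_span_range_iff_exists_fun k).1
    (hs ▸ Submodule.mem_top : g ∈ Submodule.span k (Set.range s))
  refine ⟨LinearMap.pi fun j => c j • LinearMap.id, ?_⟩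
  ext u
  rw [← hc]
  simp [LinearMap.lsum_apply, LinearMap.sum_apply]

/-- The image of the approximation `f` is a quotient of `Uⁿ`, so maps from `U` to `X ⧸ range f` lift
to `X`, then factor through `f`, and are zero. Hence this quotient is in `U^⊥`, and it vanishes if
`X` has no non-zero maps to `U^⊥`. -/
theorem isTorsionPair [Module.Finite k A] [IsNoetherianRing A] {U : FGModuleCat.{u} A}
    (hU : LiftsModuloFac U U) : IsTorsionPair (Fac U) (rightPerp U) := by
  refine ⟨fun X => ⟨fun hX Y hY f => hX.eq_zero hY f, fun h => ?_⟩,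
    fun Y => ⟨fun hY X hX f => hX.eq_zero hY f, fun h => h U (Fac.self U)⟩⟩
  obtain ⟨n, f, hf⟩ := exists_isRightApprox_pow (k := k) U X
  have hperp : rightPerp U (FGModuleCat.of A (X ⧸ LinearMap.range f)) := by
    intro g
    obtain ⟨g', rfl⟩ := hU X (FGModuleCat.of A (X ⧸ LinearMap.range f)) (LinearMap.range f).mkQ
      (Submodule.mkQ_surjective _) n f (Submodule.ker_mkQ _).symm g
    obtain ⟨g'', rfl⟩ := hf.2 U (addClosure.self U) g'
    ext x
    exact (Submodule.Quotient.mk_eq_zero _).2 ⟨_, rfl⟩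
  have h0 := h _ hperp (LinearMap.range f).mkQ
  refine ⟨n, f, LinearMap.range_eq_top.1 ?_⟩
  rw [← Submodule.ker_mkQ (LinearMap.range f)]
  exact LinearMap.ker_eq_top.2 h0

theorem exists_isCanonicalSequence [Module.Finite k A] [IsNoetherianRing A]
    {U : FGModuleCat.{u} A} (hU : LiftsModuloFac U U) (X : FGModuleCat.{u} A) :
    ∃ (L D : FGModuleCat.{u} A) (ι : L →ₗ[A] X) (β : X →ₗ[A] D),
      IsCanonicalSequence (Fac U) (rightPerp U) ι β := by
  obtain ⟨n, f, hf⟩ := exists_isRightApprox_pow (k := k) U X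
  refine ⟨FGModuleCat.of A (LinearMap.range f), FGModuleCat.of A (X ⧸ LinearMap.range f),
    (LinearMap.range f).subtype, (LinearMap.range f).mkQ, Subtype.val_injective, ?_,
    Submodule.mkQ_surjective _, ⟨n, f.rangeRestrict, f.surjective_rangeRestrict⟩, ?_⟩
  · exact LinearMap.exact_subtype_mkQ _
  · intro g
    obtain ⟨g', rfl⟩ := hU X (FGModuleCat.of A (X ⧸ LinearMap.range f)) (LinearMap.range f).mkQ
      (Submodule.mkQ_surjective _) n f (Submodule.ker_mkQ _).symm g
    obtain ⟨g'', rfl⟩ := hf.2 U (addClosure.self U) g'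
    ext x
    exact (Submodule.Quotient.mk_eq_zero _).2 ⟨_, rfl⟩

end FiniteDimensional


/-! ### Direct summands, closure of torsion classes, and the maps `β`. -/

theorem IsRetract.tail {A : Type u} [Ring A] {M : FGModuleCat.{u} A} {t : ℕ}
    {N : Fin t → FGModuleCat.{u} A} (e : M ≃ₗ[A] (∀ i, N i)) (i : Fin t) :
    IsRetract (FDMod.tail N i) M := by
  refine ⟨e.symm.toLinearMap ∘ₗ LinearMap.pi fun j =>
      if h : i < j then LinearMap.proj (⟨j, h⟩ : {j : Fin t // i < j}) else 0,
    (LinearMap.pi fun j => LinearMap.proj j.1) ∘ₗ e.toLinearMap, ?_⟩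
  refine LinearMap.ext fun x => funext fun j => ?_
  simp [j.2]

theorem IsRetract.summand {A : Type u} [Ring A] {M : FGModuleCat.{u} A} {t : ℕ}
    {N : Fin t → FGModuleCat.{u} A} (e : M ≃ₗ[A] (∀ i, N i)) (i : Fin t) :
    IsRetract (N i) M := by
  refine ⟨e.symm.toLinearMap ∘ₗ LinearMap.single A (fun j => (N j : Type u)) i,
    LinearMap.proj i ∘ₗ e.toLinearMap, ?_⟩
  ext x
  simp

theorem Fac.of_isRetract {A : Type u} [Ring A] {U M X : FGModuleCat.{u} A} (hX : Fac U X)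
    (hU : IsRetract U M) : Fac M X := by
  obtain ⟨n, f, hf⟩ := hX
  obtain ⟨i, r, hri⟩ := hU
  exact ⟨n, f ∘ₗ powMap n r, hf.comp (powMap_surjective n (IsRetract.surjective hri))⟩

/-- A quotient of `Uⁿ` is also a quotient of `Mⁿ`, so there are fewer kernels to test. -/
theorem LiftsModuloFac.restrict {A : Type u} [Ring A] {U V M : FGModuleCat.{u} A}
    (h : LiftsModuloFac V M) (hU : IsRetract U M) : LiftsModuloFac V U := by
  obtain ⟨i, r, hri⟩ := hU
  intro E Y p hp n q hq g
  refine h E Y p hp n (q ∘ₗ powMap n r) ?_ g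
  rw [LinearMap.range_comp_of_range_eq_top q
    (LinearMap.range_eq_top.2 (powMap_surjective n (IsRetract.surjective hri))), hq]

/-- A torsion class is closed under filtrations. -/
theorem IsTorsionPair.filt_le {A : Type u} [Ring A] {T F C : ObjectProperty (FGModuleCat.{u} A)}
    (h : IsTorsionPair T F) (hC : C ≤ T) : Filt C ≤ T := by
  rintro X ⟨n, c, h0, hn, hc⟩
  refine (h.left X).2 fun Y hY f => ?_
  have key : ∀ j ≤ n, c j ≤ LinearMap.ker f := by
    intro j
    induction j with
    | zero => intro _; rw [h0]; exact bot_le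
    | succ j ih =>
      intro hj
      obtain ⟨-, Z, hZ, ⟨e⟩⟩ := hc j hj
      -- Once `f` kills `c j`, its restriction to `c (j + 1)` descends to the subquotient, which
      -- lies in `T`.
      have hle : (c j).submoduleOf (c (j + 1)) ≤ LinearMap.ker (f ∘ₗ (c (j + 1)).subtype) :=
        fun x hx => ih (Nat.le_of_succ_le hj) hx
      have hz := (h.left Z).1 (hC _ hZ) Y hY
        (((c j).submoduleOf (c (j + 1))).liftQ _ hle ∘ₗ e.symm.toLinearMap)
      intro x hx
      have := LinearMap.congr_fun hz (e (Submodule.Quotient.mk ⟨x, hx⟩))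
      simpa using this
  exact LinearMap.ker_eq_top.1 (top_le_iff.1 (hn ▸ key n le_rfl))

theorem IsTorsionPair.of_surjective {A : Type u} [Ring A]
    {T F : ObjectProperty (FGModuleCat.{u} A)} (h : IsTorsionPair T F) {X Y : FGModuleCat.{u} A}
    (hX : T X) (f : X →ₗ[A] Y) (hf : Function.Surjective f) : T Y := by
  refine (h.left Y).2 fun Z hZ g => ?_
  rw [← LinearMap.cancel_right hf, LinearMap.zero_comp]
  exact (h.left X).1 hX Z hZ _

theorem IsTorsionPair.pi {A : Type u} [Ring A]
    {T F : ObjectProperty (FGModuleCat.{u} A)} (h : IsTorsionPair T F) {J : Type} [Finite J]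
    {N : J → FGModuleCat.{u} A} (hN : ∀ j, T (N j)) : T (FGModuleCat.of A (∀ j, N j)) := by
  classical
  refine (h.left _).2 fun Z hZ g => LinearMap.pi_ext' fun j => ?_
  rw [LinearMap.zero_comp]
  exact (h.left _).1 (hN j) Z hZ _

theorem IsTorsionPair.fac_le {A : Type u} [Ring A]
    {T F : ObjectProperty (FGModuleCat.{u} A)} (h : IsTorsionPair T F) {U : FGModuleCat.{u} A}
    (hU : T U) : Fac U ≤ T := by
  refine fun X hX => (h.left X).2 fun Y hY f => hX.eq_zero (fun g => ?_) f
  exact (h.left U).1 hU Y hY g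

/-- A torsion class is closed under extensions. -/
theorem IsTorsionPair.of_exact {A : Type u} [Ring A]
    {T F : ObjectProperty (FGModuleCat.{u} A)} (h : IsTorsionPair T F)
    {L X Y : FGModuleCat.{u} A} {ι : L →ₗ[A] X} {β : X →ₗ[A] Y} (hex : Function.Exact ι β)
    (hβ : Function.Surjective β) (hL : T L) (hY : T Y) : T X := by
  refine (h.left X).2 fun Z hZ g => ?_
  have h1 : LinearMap.ker β ≤ LinearMap.ker g := by
    rw [hex.linearMap_ker_eq]
    rintro _ ⟨x, rfl⟩
    exact LinearMap.congr_fun ((h.left L).1 hL Z hZ (g ∘ₗ ι)) x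
  have h2 := (h.left Y).1 hY Z hZ
    ((LinearMap.ker β).liftQ g h1 ∘ₗ (β.quotKerEquivOfSurjective hβ).symm.toLinearMap)
  ext x
  have h3 := LinearMap.congr_fun h2 (β.quotKerEquivOfSurjective hβ (Submodule.Quotient.mk x))
  simpa using h3

/-- If `β = 0`, then `ι` is onto and `X` is a quotient of its torsion part; this is where
admissibility acts. -/
theorem IsCanonicalSequence.ne_zero {A : Type u} [Ring A] {U L X Y : FGModuleCat.{u} A}
    {ι : L →ₗ[A] X} {β : X →ₗ[A] Y} (h : IsCanonicalSequence (Fac U) (rightPerp U) ι β)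
    (hX : ¬ Fac U X) : β ≠ 0 := by
  rintro rfl
  refine hX (h.torsion.of_surjective ι (LinearMap.range_eq_top.1 ?_))
  rw [← h.exact.linearMap_ker_eq, LinearMap.ker_zero]

/-- A non-zero right approximation out of an indecomposable module is right minimal. -/
theorem IsRightApprox.isRightMinimalApprox {A : Type u} [Ring A] [IsArtinianRing A]
    {C : ObjectProperty (FGModuleCat.{u} A)} {X Y : FGModuleCat.{u} A} {β : X →ₗ[A] Y}
    (h : IsRightApprox C β) (hX : Indecomposable X) (hβ : β ≠ 0) : IsRightMinimalApprox C β := by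
  refine ⟨h, fun g hg => (hX.isNilpotent_or_bijective g).resolve_left ?_⟩
  rintro ⟨n, hn⟩
  have hgn : ∀ m : ℕ, β ∘ₗ (g ^ m) = β := fun m => by
    induction m with
    | zero => rfl
    | succ m ih => rw [pow_succ, Module.End.mul_eq_comp, ← LinearMap.comp_assoc, ih, hg]
  exact hβ (by rw [← hgn n, hn, LinearMap.comp_zero])

/-- Maps from `add M` lift along the deflation of a canonical sequence for a summand of `M`. -/
theorem IsCanonicalSequence.isRightApprox {A : Type u} [Ring A] [IsNoetherianRing A]
    {M U L X Y : FGModuleCat.{u} A} {ι : L →ₗ[A] X} {β : X →ₗ[A] Y}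
    (h : IsCanonicalSequence (Fac U) (rightPerp U) ι β) (hM : LiftsModuloFac M U)
    (hX : addClosure M X) : IsRightApprox (addClosure M) β := by
  refine ⟨hX, fun X' hX' g => hX'.exists_factor β (fun f => ?_) g⟩
  obtain ⟨n, q, hq⟩ := h.torsion
  refine hM X Y β h.surjective n (ι ∘ₗ q) ?_ f
  rw [LinearMap.range_comp_of_range_eq_top ι (LinearMap.range_eq_top.2 hq),
    h.exact.linearMap_ker_eq]

end FDMod

theorem corollary3p5 {k : Type w} [Field k] {A : Type u} [Ring A] [Nontrivial A]
    [Algebra k A] [Module.Finite k A]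
    (M : FGModuleCat.{u} A) (hM : Nontrivial M) (hbasic : IsBasic M)
    (hrigid : IsTauRigid k M)
    (t : ℕ) (N : Fin t → FGModuleCat.{u} A) (hN : IsTFAdmissible M N) :
    -- the objects in the statement exist
    (∀ i, IsTorsionPair (Fac (tail N i)) (rightPerp (tail N i))) ∧
    (∀ i, ∃ (L D : FGModuleCat.{u} A) (ι : L →ₗ[A] N i) (β : N i →ₗ[A] D),
      IsCanonicalSequence (Fac (tail N i)) (rightPerp (tail N i))
        ι β) ∧
    (∀ i, ∃ (X : FGModuleCat.{u} A) (h : X →ₗ[A] N i),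
      IsRightMinimalApprox (addClosure (tail N i)) h) ∧
    -- for every choice of the canonical sequences `0 → L i → N i → Δ i → 0`
    ∀ (L Δ : Fin t → FGModuleCat.{u} A)
      (ι : ∀ i, L i →ₗ[A] N i) (β : ∀ i, N i →ₗ[A] Δ i),
      (∀ i, IsCanonicalSequence (Fac (tail N i))
        (rightPerp (tail N i)) (ι i) (β i)) →
      -- (a)
      (∀ i, (∀ (X : FGModuleCat.{u} A) (h : X →ₗ[A] N i),
          IsRightMinimalApprox (addClosure (tail N i)) h →
            LinearMap.range h = LinearMap.range (ι i)) ∧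
        LinearMap.range (ι i) = FDMod.trace (tail N i) (N i) ∧
        Nonempty (Δ i ≃ₗ[A] (N i ⧸ FDMod.trace (tail N i) (N i)))) ∧
      -- (b)
      (∀ i, IsRightMinimalApprox (addClosure M) (β i)) ∧
      -- (c)
      Filt (ObjectProperty.ofObj Δ) ≤ Fac M ∧
      IsLeast {T : ObjectProperty (FGModuleCat.{u} A) |
        IsTorsionClass T ∧ ObjectProperty.ofObj Δ ≤ T} (Fac M) := by
  have : IsArtinianRing A := IsArtinianRing.of_finite k A
  obtain ⟨e⟩ := hN.decomposition
  obtain ⟨P, hP⟩ := hrigid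
  have hlift : LiftsModuloFac M M := P.liftsModuloFac (P.exists_factor hP)
  have hU := IsRetract.tail e
  have hS := IsRetract.summand e
  have hliftU : ∀ i, LiftsModuloFac (FDMod.tail N i) (FDMod.tail N i) := fun i =>
    (hlift.of_isRetract (hU i)).restrict (hU i)
  refine ⟨fun i => isTorsionPair (k := k) (hliftU i),
    fun i => exists_isCanonicalSequence (k := k) (hliftU i) (N i), fun i => ?_, ?_⟩
  · obtain ⟨n, h, hh⟩ := exists_isRightApprox_pow (k := k) (FDMod.tail N i) (N i)
    exact hh.exists_minimal
  intro L Δ ι β hseq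
  have hpair : IsTorsionPair (Fac M) (rightPerp M) := isTorsionPair (k := k) hlift
  have hΔ : ObjectProperty.ofObj Δ ≤ Fac M := by
    rintro _ ⟨i⟩
    exact ((Fac.self (N i)).of_isRetract (hS i)).of_surjective (β i) (hseq i).surjective
  refine ⟨fun i => ⟨fun X h hh => ?_, (hseq i).range_eq_trace, ?_⟩, fun i => ?_,
    hpair.filt_le hΔ, ⟨⟨_, hpair⟩, hΔ⟩, ?_⟩
  · rw [hh.1.range_eq_trace, (hseq i).range_eq_trace]
  · rw [← (hseq i).range_eq_trace, ← (hseq i).exact.linearMap_ker_eq]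
    exact ⟨((β i).quotKerEquivOfSurjective (hseq i).surjective).symm⟩
  · refine ((hseq i).isRightApprox (hlift.restrict (hU i))
      ((addClosure.self M).of_isRetract (hS i))).isRightMinimalApprox (hN.indecomposable i)
      ((hseq i).ne_zero (hN.notMem_Fac i))
  · rintro T ⟨⟨F, hTF⟩, hT⟩
    have hmem : ∀ i, T (N i) := by
      intro i
      -- Descending induction: once all later summands are in `T`, so are `tail N i` and `L i`, and
      -- `N i` is an extension of `Δ i` by `L i`. The last index, with its empty tail, needs no
      -- separate case.
      induction i using WellFoundedGT.induction with
      | ind i ih =>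
        refine hTF.of_exact (hseq i).exact (hseq i).surjective ?_ (hT _ ⟨i⟩)
        exact hTF.fac_le (hTF.pi fun j : {j : Fin t // i < j} => ih j.1 j.2) _ (hseq i).torsion
    exact hTF.fac_le (hTF.of_surjective (hTF.pi hmem) e.symm.toLinearMap e.symm.surjective)
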